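/- Let $G$ be a finitely generated group with a finite generating set $S$, and for $g \in G$ let $\|g\|_S$ be the word length of $g$ with respect to $S$ (the least length of a word in elements of $S$ and their inverses representing $g$). For $g \in G$ with $g \neq 1$ put $$k_G^{nil}(g) = \min\{\, |G/N| : N \trianglelefteq G,\ G/N \text{ is finite and nilpotent},\ g \notin N \,\},$$ with $k_G^{nil}(g) = \infty$ if no such $N$ exists, and for $n \in \mathbb{N}$ put $$F_G^{nil}(n) = \max\{\, k_G^{nil}(g) : g \in G,\ g \neq 1,\ \|g\|_S \leq n \,\} \in \mathbb{N} \cup \{\infty\}$$ (with $F_G^{nil}(n) = 0$ if there is no such $g$). For functions $f_1, f_2$ on the natural numbers with values in $[0,\infty]$, write $f_1(n) \preceq f_2(n)$ if there is a constant $C \in \mathbb{N}$ such that $f_1(n) \leq C f_2(Cn)$ for all integers $n \geq 1$. Then $G$ is nilpotent if and only if $F_G^{nil}(n)$ grows polynomially in $\log n$, that is, there is a natural number $d$ with $F_G^{nil}(n) \preceq (\log n)^d$. Moreover, if $G$ is not nilpotent, then $F_G^{nil}$ grows at least linearly: $n \preceq F_G^{nil}(n)$. -/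

import Mathlib

/-- The word length `‖g‖_S`: the least length of an expression of `g` as a product of elements of
`S` and inverses of elements of `S`. -/
noncomputable def wordLength {G : Type*} [Group G] (S : Set G) (g : G) : ℕ :=
  sInf {n : ℕ | ∃ l : List G, (∀ x ∈ l, x ∈ S ∨ x⁻¹ ∈ S) ∧ l.prod = g ∧ l.length = n}

/-- The least order of a finite nilpotent quotient `G ⧸ N` in which the image of `g` is nontrivial.
It is `⊤` (infinity) if there is no such quotient. -/
noncomputable def nilDetection {G : Type*} [Group G] (g : G) : ℕ∞ :=
  sInf {m : ℕ∞ | ∃ (N : Subgroup G) (_ : N.Normal),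
    Finite (G ⧸ N) ∧ Group.IsNilpotent (G ⧸ N) ∧ g ∉ N ∧ m = (Nat.card (G ⧸ N) : ℕ∞)}

/-- The growth function `F_G^nil`: the maximum of `nilDetection g` over the nontrivial elements `g`
of word length at most `n` (and `0` if there are none). -/
noncomputable def nilGrowth {G : Type*} [Group G] (S : Set G) (n : ℕ) : ℕ∞ :=
  ⨆ g ∈ {g : G | g ≠ 1 ∧ wordLength S g ≤ n}, nilDetection g

/-- The relation `f₁ ⪯ f₂` between growth functions: `f₁ n ≤ C * f₂ (C * n)` for some
constant `C` and all positive integers `n`. -/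
def GrowthLE (f₁ f₂ : ℕ → ENNReal) : Prop :=
  ∃ C : ℕ, ∀ n : ℕ, 1 ≤ n → f₁ n ≤ (C : ENNReal) * f₂ (C * n)

/-- `f` grows polynomially in `log n`: `f ⪯ (log n) ^ d` for some natural number `d`. -/
def PolynomialInLog (f : ℕ → ENNReal) : Prop :=
  ∃ d : ℕ, GrowthLE f (fun n => ENNReal.ofReal (Real.log n ^ d))

/-
Suppose `G` is not nilpotent. Every term `γ_k` of the lower central series is then nontrivial, and
it is normally generated by the left-normed commutators of elements of `S`, which have length less
than `3 * 2 ^ k`. A finite nilpotent quotient in which such a commutator survives has a strictly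
decreasing lower central series of length at least `k + 1`, hence order at least `2 ^ (k + 1)`. So
`F_G^nil` grows at least linearly, which no power of the logarithm does.

Suppose `G` is nilpotent. It has finite generators `t₁, …, t_r` such that each `t_i` is central
modulo the subgroup `K` generated by the previous ones. By induction along this sequence, there are
`k, m, D` such that every `g ≠ 1` of length `n` comes with an integer `0 < a ≤ (n + 2) ^ k` with the
property that `g` is not a product of `(m * q) ^ D`-th powers unless `q ∣ a`. For `g = h * t ^ i`
outside `K` the integer is essentially the exponent `i`; for `g` in `K` the induction hypothesis
applies, because `K` is at most polynomially distorted and a high power subgroup of `⟨K, t⟩` meets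
`K` inside a power subgroup of `K`. As the least common multiple of `1, …, N` grows exponentially,
some `q = O(log n)` does not divide `a`, and the subgroup generated by the `e`-th powers has index
at most polynomial in `e`.
-/

open scoped Pointwise commutatorElement

theorem exists_not_dvd_of_lt_two_pow {a n : ℕ} (ha : 0 < a) (h : a < 2 ^ n) :
    ∃ q, 0 < q ∧ q ≤ 3 * n ∧ ¬ q ∣ a := by
  by_contra! hdvd
  have hlcm : (3 * n).lcmUpto ≤ a := by
    refine Nat.le_of_dvd ha (Finset.lcm_dvd fun q hq => ?_)
    exact hdvd q (Finset.mem_Icc.1 hq).1 (Finset.mem_Icc.1 hq).2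
  have hbernoulli : 3 * n + 1 ≤ 4 ^ n := by
    have := one_add_mul_le_pow_of_sq_nonneg (a := 3) (Nat.zero_le _) (Nat.zero_le _)
      (Nat.zero_le _) n
    simpa [add_comm, mul_comm] using this
  have hpow : 4 ^ n * 2 ^ n ≤ 4 ^ n * a := calc
    4 ^ n * 2 ^ n = 2 ^ (3 * n) := by rw [← mul_pow, pow_mul]; norm_num
    _ ≤ (3 * n + 1) * (3 * n).lcmUpto := Chebyshev.two_pow_le_mul_lcmUpto (3 * n)
    _ ≤ 4 ^ n * a := Nat.mul_le_mul hbernoulli hlcm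
  exact h.not_ge (Nat.le_of_mul_le_mul_left hpow (by positivity))

section LowerCentralSeries

variable {G : Type*} [Group G]

theorem quotientGroup_mk_mem_center_iff {N : Subgroup G} [N.Normal] {x : G} :
    (x : G ⧸ N) ∈ Subgroup.center (G ⧸ N) ↔ ∀ g, ⁅x, g⁆ ∈ N := by
  rw [Subgroup.mem_center_iff, (QuotientGroup.mk_surjective (s := N)).forall]
  refine forall_congr' fun g => ?_
  rw [← QuotientGroup.eq_one_iff, ← QuotientGroup.mk'_apply N ⁅x, g⁆, map_commutatorElement,
    commutatorElement_eq_one_iff_mul_comm]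
  exact eq_comm

theorem commutatorElement_mem_of_closure_eq_top {N : Subgroup G} [N.Normal] {S : Set G}
    (hS : Subgroup.closure S = ⊤) {x : G} (h : ∀ s ∈ S, ⁅x, s⁆ ∈ N) (g : G) : ⁅x, g⁆ ∈ N := by
  have hmem : ∀ y, ⁅x, y⁆ ∈ N ↔ y ∈ (Subgroup.centralizer {(x : G ⧸ N)}).comap
      (QuotientGroup.mk' N) := fun y => by
    rw [Subgroup.mem_comap, Subgroup.mem_centralizer_singleton_iff, ← QuotientGroup.eq_one_iff,
      ← QuotientGroup.mk'_apply N ⁅x, y⁆, map_commutatorElement,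
      commutatorElement_eq_one_iff_mul_comm]
    exact eq_comm
  have hle := (Subgroup.closure_le _).2 fun s hs => (hmem s).1 (h s hs)
  exact (hmem g).2 (hle (hS ▸ Subgroup.mem_top g))

theorem commutator_normalClosure_top {S : Set G} (hS : Subgroup.closure S = ⊤) (A : Set G) :
    ⁅Subgroup.normalClosure A, (⊤ : Subgroup G)⁆ =
      Subgroup.normalClosure (Set.image2 (fun a s => ⁅a, s⁆) A S) := by
  set N := Subgroup.normalClosure (Set.image2 (fun a s => ⁅a, s⁆) A S)
  refine le_antisymm ?_ (Subgroup.normalClosure_le_normal ?_)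
  · have hcenter : Subgroup.normalClosure A ≤
        (Subgroup.center (G ⧸ N)).comap (QuotientGroup.mk' N) :=
      Subgroup.normalClosure_le_normal fun a ha => quotientGroup_mk_mem_center_iff.2 <|
        commutatorElement_mem_of_closure_eq_top hS fun s hs =>
          Subgroup.subset_normalClosure ⟨a, ha, s, hs, rfl⟩
    exact Subgroup.commutator_le.2 fun x hx g _ => quotientGroup_mk_mem_center_iff.1 (hcenter hx) g
  · rintro _ ⟨a, ha, s, -, rfl⟩
    exact Subgroup.commutator_mem_commutator (Subgroup.subset_normalClosure ha)
      (Subgroup.mem_top s)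

/-- The left-normed commutators `⁅⁅⁅s₀, s₁⁆, …⁆, sₖ⁆` with entries in `S`. They have weight `k + 1`,
so that the index `k` agrees with the one of `Subgroup.lowerCentralSeries`. -/
def leftNormedCommutators (S : Set G) : ℕ → Set G
  | 0 => S
  | k + 1 => Set.image2 (fun x s => ⁅x, s⁆) (leftNormedCommutators S k) S

theorem leftNormedCommutators_finite {S : Set G} (hS : S.Finite) (k : ℕ) :
    (leftNormedCommutators S k).Finite := by
  induction k with
  | zero => exact hS
  | succ k ih => exact ih.image2 _ hS

theorem lowerCentralSeries_eq_normalClosure {S : Set G} (hS : Subgroup.closure S = ⊤) (k : ℕ) :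
    (⊤ : Subgroup G).lowerCentralSeries k =
      Subgroup.normalClosure (leftNormedCommutators S k) := by
  induction k with
  | zero => exact top_le_iff.1 (hS.symm.trans_le Subgroup.closure_le_normalClosure) |>.symm
  | succ k ih =>
    rw [Subgroup.lowerCentralSeries_succ, ih]
    exact commutator_normalClosure_top hS _

theorem leftNormedCommutators_subset_lowerCentralSeries {S : Set G} (hS : Subgroup.closure S = ⊤)
    (k : ℕ) : leftNormedCommutators S k ⊆ (⊤ : Subgroup G).lowerCentralSeries k := by
  rw [lowerCentralSeries_eq_normalClosure hS]
  exact Subgroup.subset_normalClosure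

theorem exists_ne_one_mem_leftNormedCommutators {S : Set G} (hS : Subgroup.closure S = ⊤)
    (hG : ¬ Group.IsNilpotent G) (k : ℕ) : ∃ x ∈ leftNormedCommutators S k, x ≠ 1 := by
  by_contra! h
  refine hG (Subgroup.nilpotent_iff_lowerCentralSeries.2 ⟨k, ?_⟩)
  rw [lowerCentralSeries_eq_normalClosure hS, Subgroup.normalClosure_eq_bot_iff]
  exact h

theorem lowerCentralSeries_succ_sup_closure {S : Set G} (hS : Subgroup.closure S = ⊤) (k : ℕ) :
    (⊤ : Subgroup G).lowerCentralSeries (k + 1) ⊔ Subgroup.closure (leftNormedCommutators S k) =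
      (⊤ : Subgroup G).lowerCentralSeries k := by
  set N := (⊤ : Subgroup G).lowerCentralSeries (k + 1) ⊔
    Subgroup.closure (leftNormedCommutators S k)
  have hle : N ≤ (⊤ : Subgroup G).lowerCentralSeries k :=
    sup_le (Subgroup.lowerCentralSeries_antitone _ k.le_succ)
      ((Subgroup.closure_le _).2 (leftNormedCommutators_subset_lowerCentralSeries hS k))
  have hnormal : N.Normal := Subgroup.commutator_top_right_le_iff.1 <|
    (Subgroup.commutator_mono hle le_rfl).trans le_sup_left
  refine hle.antisymm ?_
  rw [lowerCentralSeries_eq_normalClosure hS]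
  exact Subgroup.normalClosure_le_normal (Subgroup.subset_closure.trans
    (le_sup_right (a := (⊤ : Subgroup G).lowerCentralSeries (k + 1))))

theorem lowerCentralSeries_succ_lt [Group.IsNilpotent G] {k : ℕ}
    (h : (⊤ : Subgroup G).lowerCentralSeries k ≠ ⊥) :
    (⊤ : Subgroup G).lowerCentralSeries (k + 1) < (⊤ : Subgroup G).lowerCentralSeries k := by
  refine (Subgroup.lowerCentralSeries_antitone _ k.le_succ).lt_of_ne fun heq => h ?_
  have hconst : ∀ n, (⊤ : Subgroup G).lowerCentralSeries (k + n) =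
      (⊤ : Subgroup G).lowerCentralSeries k := by
    intro n
    induction n with
    | zero => rfl
    | succ n ih =>
      rw [← add_assoc, Subgroup.lowerCentralSeries_succ, ih,
        ← Subgroup.lowerCentralSeries_succ, heq]
  obtain ⟨n, hn⟩ := Subgroup.nilpotent_iff_lowerCentralSeries.1 ‹Group.IsNilpotent G›
  rw [← hconst n, eq_bot_iff, ← hn]
  exact Subgroup.lowerCentralSeries_antitone _ (Nat.le_add_left n k)

theorem two_pow_le_card_lowerCentralSeries [Finite G] [Group.IsNilpotent G] {i j : ℕ}
    (h : (⊤ : Subgroup G).lowerCentralSeries (i + j) ≠ ⊥) :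
    2 ^ (j + 1) ≤ Nat.card ((⊤ : Subgroup G).lowerCentralSeries i) := by
  induction j generalizing i with
  | zero => exact (Subgroup.one_lt_card_iff_ne_bot _).2 h
  | succ j ih =>
    have hne : (⊤ : Subgroup G).lowerCentralSeries i ≠ ⊥ := fun hbot =>
      h (le_bot_iff.1 (hbot ▸ Subgroup.lowerCentralSeries_antitone _ (Nat.le_add_right i (j + 1))))
    have hlt := lowerCentralSeries_succ_lt hne
    obtain ⟨m, hm⟩ := Subgroup.card_dvd_of_le hlt.le
    have hm2 : 2 ≤ m := by
      by_contra! hm1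
      refine hlt.ne (Subgroup.eq_of_le_of_card_ge hlt.le (hm.trans_le ?_))
      exact (Nat.mul_le_mul_left _ (Nat.lt_succ_iff.1 hm1)).trans_eq (mul_one _)
    rw [hm, pow_succ]
    exact Nat.mul_le_mul (ih (by rwa [add_right_comm])) hm2

end LowerCentralSeries

section WordBall

variable {G : Type*} [Group G] {S B : Set G} {m n : ℕ} {g h : G}

/-- The ball of radius `n` in the word metric of `S`: the products of at most `n` elements of
`S ∪ S⁻¹`, written as a power of `{1} ∪ S ∪ S⁻¹` for the pointwise multiplication of sets. -/
def wordBall (S : Set G) (n : ℕ) : Set G :=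
  (insert 1 (S ∪ S⁻¹)) ^ n

theorem one_mem_wordBall : 1 ∈ wordBall S n :=
  Set.one_mem_pow (Set.mem_insert 1 _)

theorem mem_wordBall_one (h : g ∈ S) : g ∈ wordBall S 1 := by
  rw [wordBall, pow_one]
  exact Or.inr (Or.inl h)

theorem mul_mem_wordBall (hg : g ∈ wordBall S m) (hh : h ∈ wordBall S n) :
    g * h ∈ wordBall S (m + n) := by
  rw [wordBall, pow_add]
  exact Set.mul_mem_mul hg hh

theorem inv_mem_wordBall_iff : g⁻¹ ∈ wordBall S n ↔ g ∈ wordBall S n := by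
  rw [← Set.mem_inv, wordBall, ← inv_pow, Set.inv_insert, Set.union_inv, inv_inv, inv_one,
    Set.union_comm]

theorem wordBall_mono (h : m ≤ n) : wordBall S m ⊆ wordBall S n :=
  Set.pow_subset_pow_right (Set.mem_insert 1 _) h

theorem zpow_mem_wordBall (hg : g ∈ wordBall S n) (i : ℤ) :
    g ^ i ∈ wordBall S (i.natAbs * n) := by
  have hpow : g ^ i.natAbs ∈ wordBall S (i.natAbs * n) := by
    rw [wordBall, mul_comm, pow_mul]
    exact Set.pow_mem_pow hg
  rcases Int.natAbs_eq i with hi | hi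
  · rwa [← zpow_natCast, ← hi] at hpow
  · rwa [← inv_mem_wordBall_iff, ← zpow_natCast, ← zpow_neg, ← hi] at hpow

theorem wordBall_subset_closure : wordBall S n ⊆ Subgroup.closure S := by
  refine Subgroup.pow_subset ?_
  exact Set.insert_subset (one_mem _) (Set.union_subset Subgroup.subset_closure
    (Set.inv_subset.2 (by simp)))

theorem exists_mem_wordBall (h : g ∈ Subgroup.closure S) : ∃ n, g ∈ wordBall S n := by
  induction h using Subgroup.closure_induction with
  | mem x hx => exact ⟨1, mem_wordBall_one hx⟩
  | one => exact ⟨0, one_mem_wordBall⟩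
  | mul x y _ _ hx hy =>
    obtain ⟨m, hm⟩ := hx
    obtain ⟨n, hn⟩ := hy
    exact ⟨m + n, mul_mem_wordBall hm hn⟩
  | inv x _ hx => exact hx.imp fun n hn => inv_mem_wordBall_iff.2 hn

theorem exists_subset_wordBall (hS : S.Finite) (h : S ⊆ Subgroup.closure B) :
    ∃ n, S ⊆ wordBall B n := by
  refine ((Filter.eventually_all_finite hS (l := Filter.atTop)).2 fun s hs => ?_).exists
  obtain ⟨n, hn⟩ := exists_mem_wordBall (h hs)
  exact (Filter.eventually_ge_atTop n).mono fun m hm => wordBall_mono hm hn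

theorem wordBall_subset_wordBall_mul (h : S ⊆ wordBall B m) (n : ℕ) :
    wordBall S n ⊆ wordBall B (m * n) := by
  rw [wordBall, wordBall, pow_mul]
  refine Set.pow_subset_pow_left (Set.insert_subset one_mem_wordBall (Set.union_subset h ?_))
  exact fun x hx => inv_mem_wordBall_iff.1 (h hx)

theorem mem_wordBall_iff_exists_list :
    g ∈ wordBall S n ↔
      ∃ l : List G, (∀ x ∈ l, x ∈ S ∨ x⁻¹ ∈ S) ∧ l.prod = g ∧ l.length ≤ n := by
  constructor
  · intro hg
    induction n generalizing g with
    | zero => exact ⟨[], by simpa [wordBall, eq_comm] using hg⟩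
    | succ n ih =>
      rw [wordBall, pow_succ'] at hg
      obtain ⟨x, hx, y, hy, rfl⟩ := hg
      obtain ⟨l, hl, rfl, hlen⟩ := ih hy
      rcases hx with rfl | hx
      · exact ⟨l, hl, (one_mul _).symm, hlen.trans n.le_succ⟩
      · exact ⟨x :: l, List.forall_mem_cons.2 ⟨hx, hl⟩, List.prod_cons, Nat.succ_le_succ hlen⟩
  · rintro ⟨l, hl, rfl, hlen⟩
    refine wordBall_mono hlen ?_
    clear hlen
    induction l with
    | nil => exact one_mem_wordBall
    | cons x l ih =>
      rw [List.forall_mem_cons] at hl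
      rw [List.prod_cons, List.length_cons, wordBall, pow_succ']
      exact Set.mul_mem_mul (Or.inr hl.1) (ih hl.2)

theorem wordLength_le_of_mem_wordBall (hg : g ∈ wordBall S n) : wordLength S g ≤ n := by
  obtain ⟨l, hl, hprod, hlen⟩ := mem_wordBall_iff_exists_list.1 hg
  refine (Nat.sInf_le ?_).trans hlen
  exact ⟨l, hl, hprod, rfl⟩

theorem mem_wordBall_of_wordLength_le (hS : Subgroup.closure S = ⊤) (h : wordLength S g ≤ n) :
    g ∈ wordBall S n := by
  obtain ⟨m, hm⟩ := exists_mem_wordBall (hS ▸ Subgroup.mem_top g)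
  obtain ⟨l, hl, hprod, -⟩ := mem_wordBall_iff_exists_list.1 hm
  obtain ⟨l', hl', hprod', hlen'⟩ := Nat.sInf_mem (s := {n | ∃ l : List G,
    (∀ x ∈ l, x ∈ S ∨ x⁻¹ ∈ S) ∧ l.prod = g ∧ l.length = n}) ⟨_, l, hl, hprod, rfl⟩
  exact mem_wordBall_iff_exists_list.2 ⟨l', hl', hprod', hlen'.trans_le h⟩

theorem leftNormedCommutators_subset_wordBall (S : Set G) (k : ℕ) :
    leftNormedCommutators S k ⊆ wordBall S (3 * 2 ^ k - 2) := by
  induction k with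
  | zero => exact fun _ hx => mem_wordBall_one hx
  | succ k ih =>
    rintro _ ⟨x, hx, s, hs, rfl⟩
    have hs' := mem_wordBall_one hs
    have hmem := mul_mem_wordBall (mul_mem_wordBall (mul_mem_wordBall (ih hx) hs')
      (inv_mem_wordBall_iff.2 (ih hx))) (inv_mem_wordBall_iff.2 hs')
    refine wordBall_mono ?_ hmem
    have := Nat.one_le_two_pow (n := k)
    omega

end WordBall

section LinearGrowth

variable {G : Type*} [Group G]

theorem two_pow_le_nilDetection {k : ℕ} {x : G}
    (hx : x ∈ (⊤ : Subgroup G).lowerCentralSeries k) :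
    ((2 ^ (k + 1) : ℕ) : ℕ∞) ≤ nilDetection x := by
  refine le_sInf ?_
  rintro _ ⟨N, hN, hfin, hnil, hxN, rfl⟩
  have hne : (⊤ : Subgroup (G ⧸ N)).lowerCentralSeries (0 + k) ≠ ⊥ := by
    rw [zero_add]
    intro hbot
    have hmem := Subgroup.mem_map_of_mem (QuotientGroup.mk' N) hx
    rw [Subgroup.map_lowerCentralSeries,
      Subgroup.map_top_of_surjective _ (QuotientGroup.mk'_surjective N), hbot,
      Subgroup.mem_bot] at hmem
    exact hxN ((QuotientGroup.eq_one_iff x).1 hmem)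
  have hcard := two_pow_le_card_lowerCentralSeries hne
  rw [Subgroup.lowerCentralSeries_zero, Subgroup.card_top] at hcard
  exact Nat.cast_le.2 hcard

theorem growthLE_nilGrowth_of_not_isNilpotent {S : Set G} (hS : Subgroup.closure S = ⊤)
    (hG : ¬ Group.IsNilpotent G) :
    GrowthLE (fun n => (n : ENNReal)) (fun n => (nilGrowth S n : ENNReal)) := by
  refine ⟨3, fun n hn => ?_⟩
  set k := Nat.log 2 n
  obtain ⟨x, hx, hx1⟩ := exists_ne_one_mem_leftNormedCommutators hS hG k
  have hkn : 2 ^ k ≤ n := Nat.pow_log_le_self 2 (by omega)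
  have hnk : n < 2 ^ (k + 1) := Nat.lt_pow_succ_log_self one_lt_two n
  have hlen : wordLength S x ≤ 3 * n := (wordLength_le_of_mem_wordBall
    (leftNormedCommutators_subset_wordBall S k hx)).trans (by omega)
  have hdetect := two_pow_le_nilDetection (leftNormedCommutators_subset_lowerCentralSeries hS k hx)
  have hgrowth : (n : ℕ∞) ≤ nilGrowth S (3 * n) :=
    (Nat.cast_le.2 hnk.le).trans (hdetect.trans (le_iSup₂_of_le x ⟨hx1, hlen⟩ le_rfl))
  calc (n : ENNReal) ≤ nilGrowth S (3 * n) := by exact_mod_cast ENat.toENNReal_le.2 hgrowth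
    _ ≤ (3 : ℕ) * (nilGrowth S (3 * n) : ENNReal) := le_mul_of_one_le_left' (by norm_num)

theorem GrowthLE.trans {f₁ f₂ f₃ : ℕ → ENNReal} (h₁₂ : GrowthLE f₁ f₂) (h₂₃ : GrowthLE f₂ f₃) :
    GrowthLE f₁ f₃ := by
  obtain ⟨C₁, h₁⟩ := h₁₂
  obtain ⟨C₂, h₂⟩ := h₂₃
  refine ⟨C₁ * C₂, fun n hn => ?_⟩
  rcases Nat.eq_zero_or_pos C₁ with rfl | hC₁
  · simpa using h₁ n hn
  · calc f₁ n ≤ C₁ * f₂ (C₁ * n) := h₁ n hn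
      _ ≤ C₁ * (C₂ * f₃ (C₂ * (C₁ * n))) := by gcongr; exact h₂ _ (Nat.mul_pos hC₁ hn)
      _ = ((C₁ * C₂ : ℕ) : ENNReal) * f₃ (C₁ * C₂ * n) := by
        rw [Nat.cast_mul, mul_assoc, mul_comm C₁ C₂, mul_assoc C₂ C₁ n]

theorem not_growthLE_natCast_log_pow (d : ℕ) :
    ¬ GrowthLE (fun n => (n : ENNReal)) (fun n => ENNReal.ofReal (Real.log n ^ d)) := by
  rintro ⟨C, hC⟩
  have hlog (n : ℕ) : 0 ≤ Real.log ((C * n : ℕ) : ℝ) := Real.log_natCast_nonneg _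
  have hle : ∀ n : ℕ, 1 ≤ n → (n : ℝ) ≤ C * Real.log ((C * n : ℕ) : ℝ) ^ d := fun n hn => by
    have : (n : ENNReal) ≤ C * ENNReal.ofReal (Real.log ((C * n : ℕ) : ℝ) ^ d) := hC n hn
    rwa [← ENNReal.ofReal_natCast C, ← ENNReal.ofReal_natCast n,
      ← ENNReal.ofReal_mul (Nat.cast_nonneg C),
      ENNReal.ofReal_le_ofReal_iff (mul_nonneg (Nat.cast_nonneg C) (pow_nonneg (hlog n) d))] at this
  have hC0 : (0 : ℝ) < C := by
    by_contra! h
    have := (hle 1 le_rfl).trans (mul_nonpos_of_nonpos_of_nonneg h (pow_nonneg (hlog 1) d))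
    norm_num at this
  have hlittle : (fun n : ℕ => C * Real.log (C * n) ^ d) =o[Filter.atTop] fun n : ℕ => (n : ℝ) := by
    have := (Real.isLittleO_pow_log_id_atTop (n := d)).comp_tendsto
      ((tendsto_natCast_atTop_atTop (R := ℝ)).const_mul_atTop hC0)
    exact (this.trans_isBigO (Asymptotics.isBigO_const_mul_self _ _ _)).const_mul_left _
  obtain ⟨n, hn, hn1⟩ :=
    ((hlittle.def (c := 1 / 2) (by norm_num)).and (Filter.eventually_ge_atTop 1)).exists
  have hn1' : (1 : ℝ) ≤ n := by exact_mod_cast hn1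
  have hupper := (le_abs_self _).trans hn
  have hlower := hle n hn1
  push_cast at hlower
  rw [Real.norm_natCast] at hupper
  linarith

end LinearGrowth

section CentralSequence

variable {G : Type*} [Group G] {B : Set G}

theorem closure_insert_eq_sup_zpowers (t : G) (B : Set G) :
    Subgroup.closure (insert t B) = Subgroup.closure B ⊔ Subgroup.zpowers t := by
  rw [Set.insert_eq, Subgroup.closure_union, ← Subgroup.zpowers_eq_closure, sup_comm]

/-- The sets `{t₁, …, tₙ}` in which every `tᵢ` is central modulo the subgroup generated by
`t₁, …, tᵢ₋₁`. Such a set generates a normal subgroup with a central series of cyclic factors;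
it replaces a polycyclic generating sequence of a nilpotent group. -/
inductive CentralSequence : Set G → Prop
  | nil : CentralSequence ∅
  | cons (B : Set G) (t : G) : CentralSequence B → (∀ g, ⁅t, g⁆ ∈ Subgroup.closure B) →
      CentralSequence (insert t B)

theorem CentralSequence.finite (hB : CentralSequence B) : B.Finite := by
  induction hB with
  | nil => exact Set.finite_empty
  | cons B t _ _ ih => exact ih.insert t

theorem CentralSequence.normal (hB : CentralSequence B) : (Subgroup.closure B).Normal := by
  induction hB with
  | nil => rw [Subgroup.closure_empty]; infer_instance
  | cons B t _ ht ih =>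
    have hcenter : Subgroup.closure (insert t B) ≤
        (Subgroup.center (G ⧸ Subgroup.closure B)).comap
          (QuotientGroup.mk' (Subgroup.closure B)) := by
      refine (Subgroup.closure_le _).2 (Set.insert_subset ?_ fun x hx => ?_)
      · exact quotientGroup_mk_mem_center_iff.2 ht
      · rw [SetLike.mem_coe, Subgroup.mem_comap, QuotientGroup.mk'_apply,
          (QuotientGroup.eq_one_iff x).2 (Subgroup.subset_closure hx)]
        exact one_mem _
    refine Subgroup.commutator_top_right_le_iff.1 (Subgroup.commutator_le.2 fun x hx g _ => ?_)
    exact Subgroup.closure_mono (Set.subset_insert t B)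
      (quotientGroup_mk_mem_center_iff.1 (hcenter hx) g)

theorem CentralSequence.union (hB : CentralSequence B) {F : Set G} (hF : F.Finite)
    (hcentral : ∀ f ∈ F, ∀ g, ⁅f, g⁆ ∈ Subgroup.closure B) : CentralSequence (F ∪ B) := by
  induction F, hF using Set.Finite.induction_on with
  | empty => rwa [Set.empty_union]
  | @insert a F _ _ ih =>
    rw [Set.insert_union]
    refine .cons _ a (ih fun f hf => hcentral f (Set.mem_insert_of_mem a hf)) fun g => ?_
    exact Subgroup.closure_mono Set.subset_union_right (hcentral a (Set.mem_insert a F) g)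

theorem exists_centralSequence_closure_eq_top [Group.FG G] [Group.IsNilpotent G] :
    ∃ B : Set G, CentralSequence B ∧ Subgroup.closure B = ⊤ := by
  obtain ⟨S, hS, hfin⟩ := Group.fg_iff.1 ‹Group.FG G›
  obtain ⟨c, hc⟩ := Subgroup.nilpotent_iff_lowerCentralSeries.1 ‹Group.IsNilpotent G›
  have hdescend : ∀ i j, i + j = c → ∃ B : Set G, CentralSequence B ∧
      Subgroup.closure B = (⊤ : Subgroup G).lowerCentralSeries j := by
    intro i
    induction i with
    | zero =>
      rintro j rfl
      rw [zero_add] at hc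
      exact ⟨∅, .nil, by rw [Subgroup.closure_empty, hc]⟩
    | succ i ih =>
      intro j hj
      obtain ⟨B, hB, hclosure⟩ := ih (j + 1) (by omega)
      refine ⟨leftNormedCommutators S j ∪ B,
        hB.union (leftNormedCommutators_finite hfin j) fun f hf g => ?_, ?_⟩
      · rw [hclosure]
        exact Subgroup.commutator_mem_commutator
          (leftNormedCommutators_subset_lowerCentralSeries hS j hf) (Subgroup.mem_top g)
      · rw [Subgroup.closure_union, hclosure, sup_comm, lowerCentralSeries_succ_sup_closure hS]
  exact hdescend c 0 (add_zero c)

end CentralSequence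

section PowerSubgroup

variable {G : Type*} [Group G] {K : Subgroup G}

/-- The subgroup generated by the `e`-th powers of the elements of `K`, in the literature often
denoted `K ^ e`. -/
def powerSubgroup (K : Subgroup G) (e : ℕ) : Subgroup G :=
  Subgroup.closure ((fun x => x ^ e) '' (K : Set G))

theorem powerSubgroup_le {H : Subgroup G} {e : ℕ} :
    powerSubgroup K e ≤ H ↔ ∀ x ∈ K, x ^ e ∈ H := by
  simp [powerSubgroup, Subgroup.closure_le, Set.subset_def]

theorem pow_mem_powerSubgroup {x : G} (hx : x ∈ K) (e : ℕ) : x ^ e ∈ powerSubgroup K e :=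
  powerSubgroup_le.1 le_rfl x hx

theorem powerSubgroup_le_self (K : Subgroup G) (e : ℕ) : powerSubgroup K e ≤ K :=
  powerSubgroup_le.2 fun _ hx => pow_mem hx e

theorem powerSubgroup_mono {H : Subgroup G} (h : K ≤ H) (e : ℕ) :
    powerSubgroup K e ≤ powerSubgroup H e :=
  powerSubgroup_le.2 fun _ hx => pow_mem_powerSubgroup (h hx) e

theorem powerSubgroup_le_of_dvd (K : Subgroup G) {d e : ℕ} (h : d ∣ e) :
    powerSubgroup K e ≤ powerSubgroup K d := by
  obtain ⟨m, rfl⟩ := h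
  refine powerSubgroup_le.2 fun x hx => ?_
  rw [pow_mul]
  exact pow_mem (pow_mem_powerSubgroup hx d) m

instance powerSubgroup_normal (K : Subgroup G) [hK : K.Normal] (e : ℕ) :
    (powerSubgroup K e).Normal := by
  refine ⟨fun x hx g => ?_⟩
  have hle : powerSubgroup K e ≤ (powerSubgroup K e).comap (MulAut.conj g).toMonoidHom := by
    refine powerSubgroup_le.2 fun y hy => ?_
    have := pow_mem_powerSubgroup (hK.conj_mem y hy g) e
    rwa [conj_pow] at this
  exact hle hx

theorem zpow_mem_iff_orderOf_mk_dvd [K.Normal] {t : G} {i : ℤ} :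
    t ^ i ∈ K ↔ (orderOf (t : G ⧸ K) : ℤ) ∣ i := by
  rw [orderOf_dvd_iff_zpow_eq_one, ← QuotientGroup.mk_zpow, QuotientGroup.eq_one_iff]

theorem mem_sup_zpowers_iff [K.Normal] {t x : G} :
    x ∈ K ⊔ Subgroup.zpowers t ↔ ∃ h ∈ K, ∃ i : ℤ, h * t ^ i = x := by
  simp only [Subgroup.mem_sup_of_normal_left, Subgroup.exists_mem_zpowers]

theorem exists_mul_zpow_pow_eq [K.Normal] {h : G} (hh : h ∈ K) (t : G) (i : ℤ) (n : ℕ) :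
    ∃ h' ∈ K, (h * t ^ i) ^ n = h' * (t ^ n) ^ i := by
  refine ⟨(h * t ^ i) ^ n * ((t ^ n) ^ i)⁻¹, ?_, by group⟩
  rw [← QuotientGroup.eq_one_iff]
  simp [(QuotientGroup.eq_one_iff h).2 hh, ← zpow_natCast, zpow_comm]

theorem powerSubgroup_sup_zpowers_le_sup [K.Normal] (t : G) (e : ℕ) :
    powerSubgroup (K ⊔ Subgroup.zpowers t) e ≤ K ⊔ Subgroup.zpowers (t ^ e) := by
  refine powerSubgroup_le.2 fun x hx => ?_
  obtain ⟨h, hh, i, rfl⟩ := mem_sup_zpowers_iff.1 hx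
  obtain ⟨h', hh', hpow⟩ := exists_mul_zpow_pow_eq hh t i e
  exact mem_sup_zpowers_iff.2 ⟨h', hh', i, hpow.symm⟩

theorem relIndex_zpowers_dvd [K.Normal] {t : G} {e : ℕ} (h : t ^ e ∈ K) :
    K.relIndex (Subgroup.zpowers t) ∣ e := by
  nth_rewrite 1 [← QuotientGroup.ker_mk' K]
  rw [Subgroup.relIndex_ker, MonoidHom.map_zpowers, Nat.card_zpowers, orderOf_dvd_iff_pow_eq_one,
    ← map_pow]
  exact (QuotientGroup.eq_one_iff _).2 h

theorem relIndex_powerSubgroup_sup_zpowers_dvd [K.Normal] (t : G)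
    [(K ⊔ Subgroup.zpowers t).Normal] (e : ℕ) :
    (powerSubgroup (K ⊔ Subgroup.zpowers t) e).relIndex (K ⊔ Subgroup.zpowers t) ∣
      (powerSubgroup K e).relIndex K * e := by
  set K' := K ⊔ Subgroup.zpowers t
  set P := powerSubgroup K' e
  have hPK' : P ≤ K' := powerSubgroup_le_self K' e
  have hsup : Subgroup.zpowers t ⊔ (K ⊔ P) = K' := by
    rw [← sup_assoc, sup_comm (Subgroup.zpowers t), sup_eq_left.2 hPK']
  rw [← Subgroup.relIndex_mul_relIndex P (K ⊔ P) K' le_sup_right (sup_le le_sup_left hPK')]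
  refine mul_dvd_mul ?_ ?_
  · rw [Subgroup.relIndex_sup_right]
    exact Subgroup.relIndex_dvd_of_le_left K (powerSubgroup_mono le_sup_left e)
  · rw [← hsup, Subgroup.relIndex_sup_right]
    have ht : t ∈ K' := le_sup_right (a := K) (Subgroup.mem_zpowers t)
    exact relIndex_zpowers_dvd (le_sup_right (a := K) (pow_mem_powerSubgroup ht e))

theorem CentralSequence.exists_relIndex_powerSubgroup_dvd {B : Set G} (hB : CentralSequence B) :
    ∃ l, ∀ e, (powerSubgroup (Subgroup.closure B) e).relIndex (Subgroup.closure B) ∣ e ^ l := by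
  induction hB with
  | nil => exact ⟨0, fun e => by simp⟩
  | cons B t hB ht ih =>
    obtain ⟨l, hl⟩ := ih
    have := hB.normal
    have hnormal := (hB.cons B t ht).normal
    rw [closure_insert_eq_sup_zpowers] at hnormal ⊢
    exact ⟨l + 1, fun e => (relIndex_powerSubgroup_sup_zpowers_dvd t e).trans
      (mul_dvd_mul_right (hl e) e)⟩

theorem commutatorElement_mem_inf_lowerCentralSeries [K.Normal] {j : ℕ} {h : G}
    (hh : h ∈ K ⊓ (⊤ : Subgroup G).lowerCentralSeries j) (u : G) :
    ⁅h, u⁆ ∈ K ⊓ (⊤ : Subgroup G).lowerCentralSeries (j + 1) :=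
  ⟨Subgroup.commutator_le_left K ⊤ (Subgroup.commutator_mem_commutator hh.1 (Subgroup.mem_top u)),
    Subgroup.commutator_mem_commutator hh.2 (Subgroup.mem_top u)⟩

-- `[h⁻¹, s]` lies one step deeper in the lower central series, so by induction it commutes with
-- `s = t ^ e ^ i`; hence conjugating `s ^ e` by `h` only produces the `e`-th power `[h⁻¹, s] ^ e`.
theorem commute_mk_pow_of_mem_inf_lowerCentralSeries [K.Normal] (t : G) (e : ℕ) {i j : ℕ}
    (hbot : (⊤ : Subgroup G).lowerCentralSeries (i + j) = ⊥) {h : G}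
    (hh : h ∈ K ⊓ (⊤ : Subgroup G).lowerCentralSeries j) :
    Commute ((t ^ e ^ i : G) : G ⧸ powerSubgroup K e) (h : G ⧸ powerSubgroup K e) := by
  induction i generalizing j h with
  | zero =>
    rw [zero_add] at hbot
    obtain rfl : h = 1 := by simpa [hbot] using hh.2
    exact Commute.one_right _
  | succ i ih =>
    set s := t ^ e ^ i
    have hmem := commutatorElement_mem_inf_lowerCentralSeries (inv_mem hh) s
    have hcomm := ih (by rwa [Nat.add_right_comm, add_assoc] at hbot) hmem
    have hsemi : SemiconjBy (h : G ⧸ powerSubgroup K e)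
        ((⁅h⁻¹, s⁆ : G) * (s : G ⧸ powerSubgroup K e)) (s : G ⧸ powerSubgroup K e) := by
      have : h * (⁅h⁻¹, s⁆ * s) = s * h := by simp [commutatorElement_def, mul_assoc]
      exact congrArg (QuotientGroup.mk (s := powerSubgroup K e)) this
    have hone : ((⁅h⁻¹, s⁆ : G) : G ⧸ powerSubgroup K e) ^ e = 1 :=
      (QuotientGroup.eq_one_iff _).2 (pow_mem_powerSubgroup hmem.1 e)
    have hpow := hsemi.pow_right e
    rw [hcomm.symm.mul_pow, hone, one_mul] at hpow
    rw [pow_succ, pow_mul]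
    exact Commute.symm hpow

theorem powerSubgroup_sup_zpowers_mul_le_of_commute [K.Normal] {t : G} {m e : ℕ}
    (hcomm : ∀ h ∈ K, Commute ((t ^ m : G) : G ⧸ powerSubgroup K e) h) :
    powerSubgroup (K ⊔ Subgroup.zpowers t) (m * e) ≤
      powerSubgroup K e ⊔ Subgroup.zpowers (t ^ m) := by
  refine powerSubgroup_le.2 fun x hx => ?_
  obtain ⟨h, hh, i, rfl⟩ := mem_sup_zpowers_iff.1 hx
  obtain ⟨h', hh', hpow⟩ := exists_mul_zpow_pow_eq hh t i m
  refine mem_sup_zpowers_iff.2 ⟨(h * t ^ i) ^ (m * e) * ((t ^ m) ^ (i * e))⁻¹, ?_, i * e, by group⟩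
  have hone : (h' : G ⧸ powerSubgroup K e) ^ e = 1 :=
    (QuotientGroup.eq_one_iff _).2 (pow_mem_powerSubgroup hh' e)
  have hpow' : ((h' * (t ^ m) ^ i : G) : G ⧸ powerSubgroup K e) ^ e =
      ((t ^ m : G) : G ⧸ powerSubgroup K e) ^ (i * e) := by
    rw [QuotientGroup.mk_mul, QuotientGroup.mk_zpow, ((hcomm h' hh').symm.zpow_right i).mul_pow,
      hone, one_mul, zpow_mul, zpow_natCast]
  rw [pow_mul, hpow, ← QuotientGroup.eq_one_iff, QuotientGroup.mk_mul, QuotientGroup.mk_pow, hpow',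
    QuotientGroup.mk_inv, QuotientGroup.mk_zpow, mul_inv_cancel]

theorem sup_zpowers_pow_inf_le_of_orderOf_mk_eq_zero [K.Normal] {P : Subgroup G} [P.Normal]
    (hP : P ≤ K) {t : G} (ht : orderOf (t : G ⧸ K) = 0) {m : ℕ} (hm : 0 < m) :
    (P ⊔ Subgroup.zpowers (t ^ m)) ⊓ K ≤ P := by
  rintro x ⟨hx, hxK⟩
  obtain ⟨p, hp, i, rfl⟩ := mem_sup_zpowers_iff.1 hx
  have hmem : t ^ (m * i : ℤ) ∈ K := by
    rw [zpow_mul, zpow_natCast]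
    exact (K.mul_mem_cancel_left (hP hp)).1 hxK
  rw [zpow_mem_iff_orderOf_mk_dvd, ht, Nat.cast_zero, zero_dvd_iff] at hmem
  obtain rfl : i = 0 := (mul_eq_zero.1 hmem).resolve_left (by exact_mod_cast hm.ne')
  simpa using hp

theorem exists_powerSubgroup_sup_zpowers_inf_le [Group.IsNilpotent G] (K : Subgroup G) [K.Normal]
    (t : G) :
    ∃ r c : ℕ, 0 < r ∧ ∀ e, 0 < e →
      powerSubgroup (K ⊔ Subgroup.zpowers t) ((r * e) ^ (c + 1)) ⊓ K ≤ powerSubgroup K e := by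
  rcases Nat.eq_zero_or_pos (orderOf (t : G ⧸ K)) with ht | ht
  · obtain ⟨c, hc⟩ := Subgroup.nilpotent_iff_lowerCentralSeries.1 ‹Group.IsNilpotent G›
    refine ⟨1, c, one_pos, fun e he => ?_⟩
    rw [one_mul, pow_succ]
    refine (inf_le_inf_right K (powerSubgroup_sup_zpowers_mul_le_of_commute fun h hh => ?_)).trans
      (sup_zpowers_pow_inf_le_of_orderOf_mk_eq_zero (powerSubgroup_le_self K e) ht (pow_pos he c))
    exact commute_mk_pow_of_mem_inf_lowerCentralSeries (j := 0) t e hc ⟨hh, Subgroup.mem_top h⟩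
  · refine ⟨orderOf (t : G ⧸ K), 0, ht, fun e _ => inf_le_left.trans ?_⟩
    have hpow : powerSubgroup (K ⊔ Subgroup.zpowers t) (orderOf (t : G ⧸ K)) ≤ K := by
      refine (powerSubgroup_sup_zpowers_le_sup t _).trans (sup_le le_rfl ?_)
      rw [Subgroup.zpowers_le, ← zpow_natCast, zpow_mem_iff_orderOf_mk_dvd]
    refine powerSubgroup_le.2 fun x hx => ?_
    rw [zero_add, pow_one, pow_mul]
    exact pow_mem_powerSubgroup (hpow (pow_mem_powerSubgroup hx _)) e

theorem exists_orderOf_mk_dvd_sub_of_mem_powerSubgroup [K.Normal] {t h : G} (hh : h ∈ K) {i : ℤ}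
    {e : ℕ} (hmem : h * t ^ i ∈ powerSubgroup (K ⊔ Subgroup.zpowers t) e) :
    ∃ j : ℤ, (orderOf (t : G ⧸ K) : ℤ) ∣ i - e * j := by
  obtain ⟨h', hh', j, hj⟩ := mem_sup_zpowers_iff.1 (powerSubgroup_sup_zpowers_le_sup t e hmem)
  refine ⟨j, zpow_mem_iff_orderOf_mk_dvd.1 ?_⟩
  have heq : t ^ (i - e * j) = h⁻¹ * h' := by
    rw [zpow_sub, zpow_mul, zpow_natCast, mul_inv_eq_iff_eq_mul, mul_assoc, hj,
      inv_mul_cancel_left]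
  exact heq ▸ mul_mem (inv_mem hh) hh'

theorem exists_dvd_of_mem_powerSubgroup_sup_zpowers (K : Subgroup G) [K.Normal] (t : G) :
    ∃ r : ℕ, 0 < r ∧ ∀ (q : ℕ) (i : ℤ), ∀ h ∈ K, h * t ^ i ∉ K →
      h * t ^ i ∈ powerSubgroup (K ⊔ Subgroup.zpowers t) (r * q) → (q : ℤ) ∣ i := by
  rcases Nat.eq_zero_or_pos (orderOf (t : G ⧸ K)) with ht | ht
  · refine ⟨1, one_pos, fun q i h hh _ hmem => ?_⟩
    obtain ⟨j, hj⟩ := exists_orderOf_mk_dvd_sub_of_mem_powerSubgroup hh hmem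
    rw [ht, Nat.cast_zero, zero_dvd_iff, one_mul, sub_eq_zero] at hj
    exact ⟨j, hj⟩
  · refine ⟨_, ht, fun q i h hh hnot hmem => absurd ?_ hnot⟩
    obtain ⟨j, hj⟩ := exists_orderOf_mk_dvd_sub_of_mem_powerSubgroup hh hmem
    rw [Nat.cast_mul, mul_assoc, dvd_sub_left (dvd_mul_right _ _),
      ← zpow_mem_iff_orderOf_mk_dvd] at hj
    exact mul_mem hh hj

end PowerSubgroup

section PolynomialDistortion

variable {G : Type*} [Group G] {B : Set G}

theorem add_two_pow_add_le (n k w : ℕ) :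
    (n + 2) ^ (k + 1 + w) + (n + 2) ^ k ≤ (n + 3) ^ (k + 1 + w) := calc
  (n + 2) ^ (k + 1 + w) + (n + 2) ^ k ≤ (n + 2) ^ (k + w) * (n + 2) + (n + 2) ^ (k + w) := by
    rw [Nat.add_right_comm, pow_succ]
    exact Nat.add_le_add_left (Nat.pow_le_pow_right (by omega) (by omega)) _
  _ = (n + 2) ^ (k + w) * (n + 3) := by ring
  _ ≤ (n + 3) ^ (k + w) * (n + 3) := by gcongr; omega
  _ = (n + 3) ^ (k + 1 + w) := by ring

-- Telescoping: conjugating `s` once more by `u` multiplies by the conjugate of `⁅s⁻¹, u⁆`, which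
-- lies one step deeper in the lower central series.
theorem exists_conj_pow_mem_wordBall [(Subgroup.closure B).Normal] (u : G) {i j : ℕ}
    (hbot : (⊤ : Subgroup G).lowerCentralSeries (i + j) = ⊥) {s : G}
    (hs : s ∈ Subgroup.closure B ⊓ (⊤ : Subgroup G).lowerCentralSeries j) :
    ∃ k, ∀ n : ℕ, u ^ n * s * (u ^ n)⁻¹ ∈ wordBall B ((n + 2) ^ k) := by
  induction i generalizing j s with
  | zero =>
    rw [zero_add] at hbot
    obtain rfl : s = 1 := by simpa [hbot] using hs.2
    exact ⟨0, fun n => by simpa using one_mem_wordBall⟩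
  | succ i ih =>
    obtain ⟨k, hk⟩ := ih (by rwa [Nat.add_right_comm, add_assoc] at hbot)
      (commutatorElement_mem_inf_lowerCentralSeries (inv_mem hs) u)
    obtain ⟨w, hw⟩ := exists_mem_wordBall hs.1
    refine ⟨k + 1 + w, fun n => ?_⟩
    induction n with
    | zero =>
      have hle : w ≤ (0 + 2) ^ (k + 1 + w) :=
        Nat.lt_two_pow_self.le.trans (Nat.pow_le_pow_right two_pos (by omega))
      simpa using wordBall_mono hle hw
    | succ n ihn =>
      have hconj : u ^ (n + 1) * s * (u ^ (n + 1))⁻¹ =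
          u ^ n * s * (u ^ n)⁻¹ * (u ^ n * ⁅s⁻¹, u⁆ * (u ^ n)⁻¹) := by
        rw [commutatorElement_def, pow_succ]
        group
      rw [hconj]
      exact wordBall_mono (add_two_pow_add_le n k w) (mul_mem_wordBall ihn (hk n))

theorem exists_conj_zpow_mem_wordBall [Group.IsNilpotent G] (hfin : B.Finite)
    [(Subgroup.closure B).Normal] (t : G) :
    ∃ k, ∀ s ∈ B, ∀ i : ℤ, t ^ i * s * (t ^ i)⁻¹ ∈ wordBall B ((i.natAbs + 2) ^ k) := by
  obtain ⟨c, hc⟩ := Subgroup.nilpotent_iff_lowerCentralSeries.1 ‹Group.IsNilpotent G›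
  refine ((Filter.eventually_all_finite hfin (l := Filter.atTop)).2 fun s hs => ?_).exists
  have hs' : s ∈ Subgroup.closure B ⊓ (⊤ : Subgroup G).lowerCentralSeries 0 :=
    ⟨Subgroup.subset_closure hs, Subgroup.mem_top s⟩
  obtain ⟨k₁, h₁⟩ := exists_conj_pow_mem_wordBall t (i := c) (j := 0) hc hs'
  obtain ⟨k₂, h₂⟩ := exists_conj_pow_mem_wordBall t⁻¹ (i := c) (j := 0) hc hs'
  filter_upwards [Filter.eventually_ge_atTop k₁, Filter.eventually_ge_atTop k₂]
    with k hk₁ hk₂ i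
  rcases Int.natAbs_eq i with hi | hi
  · have hmem := h₁ i.natAbs
    rw [← zpow_natCast, ← hi] at hmem
    exact wordBall_mono (Nat.pow_le_pow_right (Nat.succ_pos _) hk₁) hmem
  · have hmem := h₂ i.natAbs
    rw [← zpow_natCast, inv_zpow', ← hi] at hmem
    exact wordBall_mono (Nat.pow_le_pow_right (Nat.succ_pos _) hk₂) hmem

theorem exists_mul_zpow_of_mem_wordBall_insert {t : G} {N r : ℕ}
    (hconj : ∀ s ∈ B, ∀ i : ℤ, i.natAbs ≤ N → t ^ i * s * (t ^ i)⁻¹ ∈ wordBall B r)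
    {n : ℕ} (hn : n ≤ N) {g : G} (hg : g ∈ wordBall (insert t B) n) :
    ∃ i : ℤ, i.natAbs ≤ n ∧ ∃ h ∈ wordBall B (n * r), h * t ^ i = g := by
  induction n generalizing g with
  | zero => exact ⟨0, le_rfl, 1, one_mem_wordBall, by simpa [wordBall, eq_comm] using hg⟩
  | succ n ih =>
    rw [wordBall, pow_succ] at hg
    obtain ⟨g', hg', x, hx, rfl⟩ := hg
    obtain ⟨i, hi, h, hh, rfl⟩ := ih (by omega) hg'
    have hh' : h ∈ wordBall B ((n + 1) * r) :=
      wordBall_mono (Nat.mul_le_mul_right r n.le_succ) hh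
    have hstep : ∀ y, t ^ i * y * (t ^ i)⁻¹ ∈ wordBall B r → ∃ j : ℤ, j.natAbs ≤ n + 1 ∧
        ∃ h' ∈ wordBall B ((n + 1) * r), h' * t ^ j = h * t ^ i * y := fun y hy =>
      ⟨i, by omega, h * (t ^ i * y * (t ^ i)⁻¹), by
        rw [Nat.succ_mul]; exact mul_mem_wordBall hh hy, by group⟩
    rcases hx with rfl | (rfl | hx) | hx
    · exact ⟨i, by omega, h, hh', (mul_one _).symm⟩
    · exact ⟨i + 1, by omega, h, hh', by rw [zpow_add_one, ← mul_assoc]⟩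
    · exact hstep x (hconj x hx i (by omega))
    · rcases hx with hx | hx
      · obtain rfl : x = t⁻¹ := inv_eq_iff_eq_inv.1 hx
        exact ⟨i - 1, by omega, h, hh', by rw [zpow_sub_one, ← mul_assoc]⟩
      · refine hstep x (inv_mem_wordBall_iff.1 ?_)
        simpa [mul_assoc] using hconj x⁻¹ hx i (by omega)

theorem exists_zpow_mem_wordBall [(Subgroup.closure B).Normal] (t : G) :
    ∃ w, ∀ i : ℤ, t ^ i ∈ Subgroup.closure B → t ^ i ∈ wordBall B (i.natAbs * w) := by
  set r := orderOf (t : G ⧸ Subgroup.closure B)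
  have hr : t ^ (r : ℤ) ∈ Subgroup.closure B := zpow_mem_iff_orderOf_mk_dvd.2 dvd_rfl
  obtain ⟨w, hw⟩ := exists_mem_wordBall hr
  refine ⟨w, fun i hi => ?_⟩
  obtain ⟨j, rfl⟩ := zpow_mem_iff_orderOf_mk_dvd.1 hi
  rcases Nat.eq_zero_or_pos r with hr0 | hr0
  · simpa [r, hr0] using one_mem_wordBall
  · rw [zpow_mul]
    refine wordBall_mono (Nat.mul_le_mul_right w ?_) (zpow_mem_wordBall hw j)
    rw [Int.natAbs_mul]
    exact Nat.le_mul_of_pos_left _ hr0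

theorem exists_wordBall_insert_subset [Group.IsNilpotent G] (hfin : B.Finite)
    [(Subgroup.closure B).Normal] (t : G) :
    ∃ k, ∀ n, ∀ g ∈ wordBall (insert t B) n, ∃ i : ℤ, i.natAbs ≤ n ∧
      ∃ h ∈ wordBall B (n * (n + 2) ^ k), h * t ^ i = g := by
  obtain ⟨k, hk⟩ := exists_conj_zpow_mem_wordBall hfin t
  refine ⟨k, fun n g hg => exists_mul_zpow_of_mem_wordBall_insert (fun s hs i hi => ?_) le_rfl hg⟩
  exact wordBall_mono (Nat.pow_le_pow_left (by omega) k) (hk s hs i)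

theorem exists_wordBall_insert_inter_closure_subset [Group.IsNilpotent G] (hfin : B.Finite)
    [(Subgroup.closure B).Normal] (t : G) :
    ∃ k, ∀ n, wordBall (insert t B) n ∩ Subgroup.closure B ⊆ wordBall B ((n + 2) ^ k) := by
  obtain ⟨k, hk⟩ := exists_wordBall_insert_subset hfin t
  obtain ⟨w, hw⟩ := exists_zpow_mem_wordBall (B := B) t
  refine ⟨k + 1 + w, fun n g ⟨hg, hgB⟩ => ?_⟩
  obtain ⟨i, hi, h, hh, rfl⟩ := hk n g hg
  have hti := hw i ((Subgroup.mul_mem_cancel_left _ (wordBall_subset_closure hh)).1 hgB)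
  refine wordBall_mono ?_ (mul_mem_wordBall hh hti)
  have hw' : w + 1 ≤ (n + 2) ^ w :=
    Nat.lt_two_pow_self.trans_le (Nat.pow_le_pow_left (by omega) w)
  calc n * (n + 2) ^ k + i.natAbs * w
      ≤ (n + 2) * (n + 2) ^ k + (n + 2) * ((n + 2) ^ k * w) := by
        refine Nat.add_le_add (Nat.mul_le_mul_right _ (by omega)) (Nat.mul_le_mul (by omega) ?_)
        exact Nat.le_mul_of_pos_left w (by positivity)
    _ = (n + 2) ^ (k + 1) * (w + 1) := by ring
    _ ≤ (n + 2) ^ (k + 1) * (n + 2) ^ w := Nat.mul_le_mul_left _ hw'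
    _ = (n + 2) ^ (k + 1 + w) := (pow_add _ _ _).symm

end PolynomialDistortion

section Separation

variable {G : Type*} [Group G]

theorem exists_dvd_of_mem_powerSubgroup_insert [Group.IsNilpotent G] {B : Set G} (hfin : B.Finite)
    [(Subgroup.closure B).Normal] (t : G) :
    ∃ r, 0 < r ∧ ∀ n, ∀ g ∈ wordBall (insert t B) n, g ∉ Subgroup.closure B →
      ∃ a, 0 < a ∧ a ≤ n ∧
        ∀ q, g ∈ powerSubgroup (Subgroup.closure (insert t B)) (r * q) → q ∣ a := by
  obtain ⟨r, hr, hdvd⟩ := exists_dvd_of_mem_powerSubgroup_sup_zpowers (Subgroup.closure B) t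
  obtain ⟨k, hk⟩ := exists_wordBall_insert_subset hfin t
  refine ⟨r, hr, fun n g hg hgB => ?_⟩
  obtain ⟨i, hi, h, hh, rfl⟩ := hk n g hg
  have hhB := wordBall_subset_closure hh
  refine ⟨i.natAbs, ?_, hi, fun q hq => ?_⟩
  · refine Int.natAbs_pos.2 ?_
    rintro rfl
    exact hgB (by rwa [zpow_zero, mul_one])
  · rw [closure_insert_eq_sup_zpowers] at hq
    exact Int.natCast_dvd.1 (hdvd q i h hhB hgB hq)

theorem pow_add_two_pow_le (n a b : ℕ) : ((n + 2) ^ a + 2) ^ b ≤ (n + 2) ^ ((a + 2) * b) := by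
  rw [pow_mul]
  refine Nat.pow_le_pow_left ?_ b
  have ha : 1 ≤ (n + 2) ^ a := Nat.one_le_pow _ _ (Nat.succ_pos _)
  calc (n + 2) ^ a + 2 ≤ (n + 2) ^ a * 2 ^ 2 := by omega
    _ ≤ (n + 2) ^ a * (n + 2) ^ 2 := Nat.mul_le_mul_left _ (Nat.pow_le_pow_left (by omega) 2)
    _ = (n + 2) ^ (a + 2) := (pow_add _ _ _).symm

theorem CentralSequence.exists_dvd_of_mem_powerSubgroup [Group.IsNilpotent G] {B : Set G}
    (hB : CentralSequence B) :
    ∃ k m D, 0 < m ∧ ∀ n, ∀ g ∈ wordBall B n, g ≠ 1 → ∃ a, 0 < a ∧ a ≤ (n + 2) ^ k ∧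
      ∀ q, 0 < q → g ∈ powerSubgroup (Subgroup.closure B) ((m * q) ^ D) → q ∣ a := by
  induction hB with
  | nil =>
    refine ⟨0, 1, 0, one_pos, fun n g hg hg1 => absurd ?_ hg1⟩
    simpa using wordBall_subset_closure hg
  | cons B t hB _ ih =>
    obtain ⟨k, m, D, hm, ih⟩ := ih
    have := hB.normal
    obtain ⟨k₀, hk₀⟩ := exists_wordBall_insert_inter_closure_subset hB.finite t
    obtain ⟨r₁, c, hr₁, hinf⟩ := exists_powerSubgroup_sup_zpowers_inf_le (Subgroup.closure B) t
    obtain ⟨r₂, hr₂, houtside⟩ := exists_dvd_of_mem_powerSubgroup_insert hB.finite t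
    refine ⟨(k₀ + 2) * k + 1, r₁ * r₂ * m, (D + 1) * (c + 1), by positivity, fun n g hg hg1 => ?_⟩
    by_cases hgB : g ∈ Subgroup.closure B
    · obtain ⟨a, ha, hale, hdvd⟩ := ih _ g (hk₀ n ⟨hg, hgB⟩) hg1
      refine ⟨a, ha, ?_, fun q hq hgq => hdvd q hq ?_⟩
      · exact hale.trans ((pow_add_two_pow_le n k₀ k).trans
          (Nat.pow_le_pow_right (Nat.succ_pos _) (Nat.le_succ _)))
      · have he : (r₁ * (m * q) ^ D) ^ (c + 1) ∣ (r₁ * r₂ * m * q) ^ ((D + 1) * (c + 1)) := by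
          rw [pow_mul, pow_succ' _ D]
          exact pow_dvd_pow_of_dvd (mul_dvd_mul ⟨r₂ * m * q, by ring⟩
            (pow_dvd_pow_of_dvd ⟨r₁ * r₂, by ring⟩ D)) _
        rw [closure_insert_eq_sup_zpowers] at hgq
        exact hinf _ (by positivity) ⟨powerSubgroup_le_of_dvd _ he hgq, hgB⟩
    · obtain ⟨a, ha, hale, hdvd⟩ := houtside n g hg hgB
      refine ⟨a, ha, ?_, fun q _ hgq => hdvd q (powerSubgroup_le_of_dvd _ ?_ hgq)⟩
      · exact (hale.trans (Nat.le_add_right n 2)).trans (Nat.le_self_pow (Nat.succ_ne_zero _) _)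
      · exact Dvd.dvd.trans ⟨r₁ * m, by ring⟩ (dvd_pow_self _ (by positivity))

theorem exists_index_powerSubgroup_top_dvd (G : Type*) [Group G] [Group.FG G]
    [Group.IsNilpotent G] :
    ∃ l, ∀ e, (powerSubgroup (⊤ : Subgroup G) e).index ∣ e ^ l := by
  obtain ⟨B, hB, hBtop⟩ := exists_centralSequence_closure_eq_top (G := G)
  obtain ⟨l, hl⟩ := hB.exists_relIndex_powerSubgroup_dvd
  exact ⟨l, fun e => by simpa only [hBtop, Subgroup.relIndex_top_right] using hl e⟩

theorem exists_dvd_of_mem_powerSubgroup_top [Group.IsNilpotent G] {S : Set G} (hSfin : S.Finite)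
    (hS : Subgroup.closure S = ⊤) :
    ∃ k m D, 0 < m ∧ ∀ n, ∀ g : G, wordLength S g ≤ n → g ≠ 1 → ∃ a, 0 < a ∧ a ≤ (n + 2) ^ k ∧
      ∀ q, 0 < q → g ∈ powerSubgroup (⊤ : Subgroup G) ((m * q) ^ D) → q ∣ a := by
  have : Group.FG G := Group.fg_iff.2 ⟨S, hS, hSfin⟩
  obtain ⟨B, hB, hBtop⟩ := exists_centralSequence_closure_eq_top (G := G)
  obtain ⟨k, m, D, hm, hsep⟩ := hB.exists_dvd_of_mem_powerSubgroup
  obtain ⟨R, hR⟩ := exists_subset_wordBall (B := B) hSfin (hBtop ▸ fun x _ => Subgroup.mem_top x)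
  refine ⟨(R + 1) * k, m, D, hm, fun n g hg hg1 => ?_⟩
  obtain ⟨a, ha, hale, hdvd⟩ :=
    hsep _ g (wordBall_subset_wordBall_mul hR n (mem_wordBall_of_wordLength_le hS hg)) hg1
  refine ⟨a, ha, hale.trans ?_, by rwa [hBtop] at hdvd⟩
  have hlin : R * n + 2 ≤ (n + 2) ^ (R + 1) := calc
    R * n + 2 ≤ (R + 1) * (n + 2) := by nlinarith
    _ ≤ 2 ^ R * (n + 2) := Nat.mul_le_mul_right _ Nat.lt_two_pow_self
    _ ≤ (n + 2) ^ R * (n + 2) := Nat.mul_le_mul_right _ (Nat.pow_le_pow_left (by omega) R)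
    _ = (n + 2) ^ (R + 1) := (pow_succ _ _).symm
  exact (Nat.pow_le_pow_left hlin k).trans_eq (pow_mul _ _ _).symm

end Separation

section PolylogarithmicGrowth

theorem exists_pos_not_dvd_of_le_add_two_pow {a n k : ℕ} (ha : 0 < a) (h : a ≤ (n + 2) ^ k) :
    ∃ q, 0 < q ∧ q ≤ 3 * (2 * k + 1) * (Nat.log 2 n + 1) ∧ ¬ q ∣ a := by
  set L := Nat.log 2 n + 1
  have hn : n + 2 ≤ 2 ^ (L + 1) := by
    have : n < 2 ^ L := Nat.lt_pow_succ_log_self one_lt_two n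
    rw [pow_succ]
    omega
  have haN : a < 2 ^ ((L + 1) * k + 1) := calc
    a ≤ (2 ^ (L + 1)) ^ k := h.trans (Nat.pow_le_pow_left hn k)
    _ = 2 ^ ((L + 1) * k) := (pow_mul _ _ _).symm
    _ < 2 ^ ((L + 1) * k + 1) := Nat.pow_lt_pow_succ one_lt_two
  obtain ⟨q, hq, hqN, hqa⟩ := exists_not_dvd_of_lt_two_pow ha haN
  refine ⟨q, hq, hqN.trans ?_, hqa⟩
  have hL : 1 ≤ L := Nat.le_add_left 1 _
  nlinarith [Nat.mul_le_mul_right k hL]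

theorem exists_nilDetection_le {G : Type*} [Group G] [Group.IsNilpotent G] {S : Set G}
    (hSfin : S.Finite) (hS : Subgroup.closure S = ⊤) :
    ∃ M d, ∀ n, ∀ g : G, wordLength S g ≤ n → g ≠ 1 →
      nilDetection g ≤ (((M * (Nat.log 2 n + 1)) ^ d : ℕ) : ℕ∞) := by
  have : Group.FG G := Group.fg_iff.2 ⟨S, hS, hSfin⟩
  obtain ⟨k, m, D, hm, hsep⟩ := exists_dvd_of_mem_powerSubgroup_top hSfin hS
  obtain ⟨l, hl⟩ := exists_index_powerSubgroup_top_dvd G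
  refine ⟨m * (3 * (2 * k + 1)), D * l, fun n g hg hg1 => ?_⟩
  obtain ⟨a, ha, hale, hdvd⟩ := hsep n g hg hg1
  obtain ⟨q, hq, hqle, hqa⟩ := exists_pos_not_dvd_of_le_add_two_pow ha hale
  set N := powerSubgroup (⊤ : Subgroup G) ((m * q) ^ D)
  have hpos : 0 < ((m * q) ^ D) ^ l := by positivity
  have hfin : Finite (G ⧸ N) :=
    Nat.finite_of_card_ne_zero (ne_zero_of_dvd_ne_zero hpos.ne' (hl _))
  have hindex : N.index ≤ (m * (3 * (2 * k + 1)) * (Nat.log 2 n + 1)) ^ (D * l) := calc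
    N.index ≤ (m * q) ^ (D * l) := (Nat.le_of_dvd hpos (hl _)).trans_eq (pow_mul _ _ _).symm
    _ ≤ _ := by
      rw [mul_assoc]
      gcongr
  refine le_trans (sInf_le ?_) (Nat.cast_le.2 hindex)
  exact ⟨N, inferInstance, hfin, inferInstance, mt (hdvd q hq) hqa, rfl⟩

theorem natLog_two_add_one_le_two_mul_log {C n : ℕ} (hC : 3 ≤ C) (hn : 1 ≤ n) :
    (Nat.log 2 n + 1 : ℝ) ≤ 2 * Real.log ((C * n : ℕ) : ℝ) := by
  have hC' : (3 : ℝ) ≤ C := by exact_mod_cast hC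
  have hn' : (1 : ℝ) ≤ n := by exact_mod_cast hn
  have hlogC : 1 ≤ Real.log C := by
    rw [Real.le_log_iff_exp_le (by linarith)]
    exact (Real.exp_one_lt_three.trans_le hC').le
  have hlogn : (Nat.log 2 n : ℝ) ≤ 2 * Real.log n := by
    have hle := Real.natLog_le_logb n 2
    rw [Real.logb, le_div_iff₀ (Real.log_pos (by norm_num)), Nat.cast_ofNat] at hle
    have hlog2 := Real.log_two_gt_d9
    nlinarith [(Nat.log 2 n).cast_nonneg (α := ℝ)]
  rw [Nat.cast_mul, Real.log_mul (by linarith) (by linarith)]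
  linarith

theorem polynomialInLog_of_le_natLog_pow {f : ℕ → ENNReal} {M d : ℕ}
    (hf : ∀ n, f n ≤ (((M * (Nat.log 2 n + 1)) ^ d : ℕ) : ENNReal)) : PolynomialInLog f := by
  refine ⟨d, 3 + (2 * M) ^ d, fun n hn => (hf n).trans ?_⟩
  set C := 3 + (2 * M) ^ d
  set L := Real.log ((C * n : ℕ) : ℝ)
  have hL : 0 ≤ L := Real.log_natCast_nonneg _
  have hlog : (Nat.log 2 n + 1 : ℝ) ≤ 2 * L :=
    natLog_two_add_one_le_two_mul_log (Nat.le_add_right 3 _) hn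
  have hC : ((2 * M : ℝ)) ^ d ≤ C := by exact_mod_cast Nat.le_add_left _ 3
  have hreal : (((M * (Nat.log 2 n + 1)) ^ d : ℕ) : ℝ) ≤ C * L ^ d := calc
    (((M * (Nat.log 2 n + 1)) ^ d : ℕ) : ℝ) = (M * (Nat.log 2 n + 1 : ℝ)) ^ d := by push_cast; rfl
    _ ≤ (M * (2 * L)) ^ d := by gcongr
    _ = (2 * M) ^ d * L ^ d := by ring
    _ ≤ C * L ^ d := mul_le_mul_of_nonneg_right hC (pow_nonneg hL d)
  rw [← ENNReal.ofReal_natCast, ← ENNReal.ofReal_natCast C, ← ENNReal.ofReal_mul (by positivity)]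
  exact ENNReal.ofReal_le_ofReal hreal

theorem polynomialInLog_nilGrowth {G : Type*} [Group G] [Group.IsNilpotent G] {S : Set G}
    (hSfin : S.Finite) (hS : Subgroup.closure S = ⊤) :
    PolynomialInLog (fun n => (nilGrowth S n : ENNReal)) := by
  obtain ⟨M, d, h⟩ := exists_nilDetection_le hSfin hS
  refine polynomialInLog_of_le_natLog_pow (M := M) (d := d) fun n => ?_
  have hle : nilGrowth S n ≤ (((M * (Nat.log 2 n + 1)) ^ d : ℕ) : ℕ∞) :=
    iSup₂_le fun g hg => h n g hg.2 hg.1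
  exact_mod_cast ENat.toENNReal_le.2 hle

end PolylogarithmicGrowth

theorem theorem3 {G : Type*} [Group G] (S : Set G) (hSfin : S.Finite)
    (hS : Subgroup.closure S = ⊤) :
    (PolynomialInLog (fun n => (nilGrowth S n : ENNReal)) ↔ Group.IsNilpotent G) ∧
    (¬ Group.IsNilpotent G →
      GrowthLE (fun n => (n : ENNReal)) (fun n => (nilGrowth S n : ENNReal))) := by
  refine ⟨⟨fun ⟨d, hd⟩ => ?_, fun hG => polynomialInLog_nilGrowth hSfin hS⟩,
    growthLE_nilGrowth_of_not_isNilpotent hS⟩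
  by_contra hG
  exact not_growthLE_natCast_log_pow d ((growthLE_nilGrowth_of_not_isNilpotent hS hG).trans hd)
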